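/- Let $\mathcal X,\mathcal Y$ be finite alphabets, $m=|\mathcal Y|$, and let $W=(W(y|x))_{x\in\mathcal X,y\in\mathcal Y}$ be a row-stochastic matrix with strictly positive entries. The noisy permutation channel of blocklength $n$ sends $x^n\in\mathcal X^n$ through the memoryless channel $W$, giving $Z^n$ with law $\prod_{i=1}^n W(z_i|x_i)$, and then outputs $Y^n$ with $Y_{\sigma(i)}=Z_i$ for $1\le i\le n$, where $\sigma$ is an independent uniformly random permutation of $\{1,\dots,n\}$. A code consists of a finite nonempty message set $\mathcal M$, an encoder $f:\mathcal M\to\mathcal X^n$ and a decoder $g:\mathcal Y^n\to\mathcal M\cup\{\mathtt e\}$; its average error probability is $P_e=\mathbb P[g(Y^n)\neq U]$, where $U$ is uniform on $\mathcal M$ and $X^n=f(U)$. For $\epsilon\in(0,1)$ let $M^\star(n,\epsilon)$ be the largest $|\mathcal M|$ over all codes of blocklength $n$ with $P_e\le\epsilon$. Let $\mathcal P_W=\operatorname{conv}\{W(\cdot|x):x\in\mathcal X\}\subseteq\mathbb R^m$, let $A=\operatorname{aff}(\mathcal P_W)$, let $d=\dim A$ be the affine dimension of $\mathcal P_W$,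 and let $\mathcal R_W=A\cap\Delta_{m-1}$, where $\Delta_{m-1}$ is the probability simplex in $\mathbb R^m$. Define $$\lambda_W^\star=\frac{\operatorname{vol}_d(\mathcal P_W)}{\inf\{\operatorname{vol}_d(S): S \text{ a } d\text{-simplex},\ \mathcal R_W\subseteq S\subseteq A\}},$$ where $\operatorname{vol}_d$ is the $d$-dimensional Euclidean volume on $A$. Theorem. Suppose $d\ge 1$. For every $a>0$ and every $\epsilon\in(0,1)$ there is a constant $C_{W,\epsilon,a}<\infty$, depending only on $W$, $\epsilon$ and $a$, such that for all sufficiently large $n$ $$\log M^\star(n,\epsilon)\le d\log\left(\frac{\sqrt n}{a}\right)+\log\lambda_W^\star+C_{W,\epsilon,a},$$ where all logarithms are to base two. -/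

import Mathlib

open MeasureTheory

noncomputable section

namespace NoisyPerm

/-! ### The noisy permutation channel and its codes -/

section Channel

variable {X Y : Type*} [Fintype Y] [DecidableEq Y]

/-- A row-stochastic matrix `W`, where `W x y` is the probability `W(y|x)`. -/
structure IsChannel (W : Matrix X Y ℝ) : Prop where
  nonneg : ∀ x y, 0 ≤ W x y
  row_sum : ∀ x, ∑ y, W x y = 1

/-- The memoryless law of the noisy codeword `z` given the input codeword `x`. -/
def dmcLaw (W : Matrix X Y ℝ) {n : ℕ} (x : Fin n → X) (z : Fin n → Y) : ℝ :=
  ∏ i, W (x i) (z i)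

/-- The uniformly random permutation block: the probability that `y (σ i) = z i` for all `i`,
where `σ` is uniform on the symmetric group. -/
def permBlock {n : ℕ} (z y : Fin n → Y) : ℝ :=
  (Finset.card {σ : Equiv.Perm (Fin n) | ∀ i, y (σ i) = z i} : ℝ) / (n.factorial : ℝ)

/-- The transition kernel of the noisy permutation channel: the memoryless channel followed by the
random permutation block. -/
def permKernel (W : Matrix X Y ℝ) {n : ℕ} (x : Fin n → X) (y : Fin n → Y) : ℝ :=
  ∑ z : Fin n → Y, dmcLaw W x z * permBlock z y

/-- A code of blocklength `n` with `M` messages; the value `none` of the decoder is the error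
symbol. -/
structure Code (X Y : Type*) (n M : ℕ) where
  enc : Fin M → (Fin n → X)
  dec : (Fin n → Y) → Option (Fin M)

/-- The average error probability, for a uniformly distributed message. -/
def avgError (W : Matrix X Y ℝ) {n M : ℕ} (c : Code X Y n M) : ℝ :=
  (∑ u : Fin M, ∑ y : Fin n → Y, if c.dec y ≠ some u then permKernel W (c.enc u) y else 0) / M

/-- The sizes of the (nonempty) message sets of codes of blocklength `n` whose average error
probability is at most `ε`. -/
def achievableSizes (W : Matrix X Y ℝ) (n : ℕ) (ε : ℝ) : Set ℕ :=
  {M | 1 ≤ M ∧ ∃ c : Code X Y n M, avgError W c ≤ ε}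

/-- The maximal code size `M⋆(n, ε)`; see `isGreatest_Mstar`. -/
def Mstar (W : Matrix X Y ℝ) (n : ℕ) (ε : ℝ) : ℕ :=
  sSup (achievableSizes W n ε)

end Channel

/-! ### The geometry of the reachable output distributions -/

section Geometry

variable {X Y : Type*} [Fintype Y]

/-- The output distribution `W(·|x)` as a point of Euclidean space. -/
def row (W : Matrix X Y ℝ) (x : X) : EuclideanSpace ℝ Y := WithLp.toLp 2 (W x)

/-- The reachable output polytope: the convex hull of the rows of `W`. -/
def polytope (W : Matrix X Y ℝ) : Set (EuclideanSpace ℝ Y) :=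
  convexHull ℝ (Set.range (row W))

/-- The affine dimension of the reachable output polytope. -/
def dimP (W : Matrix X Y ℝ) : ℕ :=
  Module.finrank ℝ (affineSpan ℝ (polytope W)).direction

/-- The probability simplex over the output alphabet. -/
def outputSimplex (Y : Type*) [Fintype Y] : Set (EuclideanSpace ℝ Y) :=
  {q | (∀ y, 0 ≤ q y) ∧ ∑ y, q y = 1}

/-- The part of the output simplex in the affine hull of the reachable output polytope. -/
def refRegion (W : Matrix X Y ℝ) : Set (EuclideanSpace ℝ Y) :=
  (affineSpan ℝ (polytope W) : Set (EuclideanSpace ℝ Y)) ∩ outputSimplex Y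

/-- The infimum of the `d`-dimensional Euclidean volumes of the `d`-simplices `S` that contain
`refRegion W` and lie in the affine hull of `polytope W`, where `d = dimP W`. The measure `μHE[d]`
is the `d`-dimensional Hausdorff measure normalized so as to agree with the Lebesgue measure. -/
def minSimplexVol (W : Matrix X Y ℝ) : ENNReal :=
  ⨅ (S : Affine.Simplex ℝ (EuclideanSpace ℝ Y) (dimP W))
    (_ : refRegion W ⊆ convexHull ℝ (Set.range S.points))
    (_ : convexHull ℝ (Set.range S.points) ⊆ affineSpan ℝ (polytope W)),
    μHE[dimP W] (convexHull ℝ (Set.range S.points))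

/-- The relative volume ratio `λ_W⋆`; it is positive by `lambdaStar_pos`. -/
def lambdaStar (W : Matrix X Y ℝ) : ℝ :=
  (μHE[dimP W] (polytope W) / minSimplexVol W).toReal

end Geometry

/-! ### The maximum and the logarithm of the volume ratio are well defined -/

section WellDefined

variable {X Y : Type*} [Fintype Y] [DecidableEq Y]

theorem permBlock_nonneg {Y : Type*} [DecidableEq Y] {n : ℕ} (z y : Fin n → Y) : 0 ≤ permBlock z y := by
  unfold permBlock; positivity

theorem sum_permBlock {n : ℕ} (z : Fin n → Y) : ∑ y, permBlock z y = 1 := by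
  unfold permBlock
  rw [← Finset.sum_div, div_eq_one_iff_eq (by positivity)]
  have h : ∀ y : Fin n → Y,
      (Finset.card {σ : Equiv.Perm (Fin n) | ∀ i, y (σ i) = z i} : ℝ) =
        ∑ σ : Equiv.Perm (Fin n), if y = z ∘ σ.symm then 1 else 0 := by
    intro y
    rw [Finset.sum_boole]
    congr 2
    ext σ
    simp only [Finset.mem_filter, Finset.mem_univ, true_and]
    constructor
    · intro h
      funext j
      simpa using h (σ.symm j)
    · rintro rfl i
      simp
  simp_rw [h]
  rw [Finset.sum_comm]
  simp [Fintype.card_perm]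

theorem permKernel_nonneg {W : Matrix X Y ℝ} (hW : IsChannel W) {n : ℕ} (x : Fin n → X)
    (y : Fin n → Y) : 0 ≤ permKernel W x y :=
  Finset.sum_nonneg fun _ _ =>
    mul_nonneg (Finset.prod_nonneg fun _ _ => hW.nonneg _ _) (permBlock_nonneg _ _)

theorem sum_permKernel {W : Matrix X Y ℝ} (hW : IsChannel W) {n : ℕ} (x : Fin n → X) :
    ∑ y, permKernel W x y = 1 := by
  unfold permKernel
  rw [Finset.sum_comm]
  simp_rw [← Finset.mul_sum, sum_permBlock, mul_one, dmcLaw]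
  rw [← Fintype.prod_sum fun i y => W (x i) y]
  simp [hW.row_sum]

theorem permKernel_le_one {W : Matrix X Y ℝ} (hW : IsChannel W) {n : ℕ} (x : Fin n → X)
    (y : Fin n → Y) : permKernel W x y ≤ 1 := by
  rw [← sum_permKernel hW x]
  exact Finset.single_le_sum (fun y _ => permKernel_nonneg hW x y) (Finset.mem_univ y)

theorem bddAbove_achievableSizes {W : Matrix X Y ℝ} (hW : IsChannel W) (n : ℕ) {ε : ℝ}
    (hε : ε < 1) : BddAbove (achievableSizes W n ε) := by
  refine ⟨⌈(Fintype.card (Fin n → Y) : ℝ) / (1 - ε)⌉₊, ?_⟩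
  rintro M ⟨hM, c, hc⟩
  have hM' : (0 : ℝ) < M := by exact_mod_cast hM
  rw [avgError, div_le_iff₀ hM'] at hc
  have h1 : ∑ u : Fin M, ∑ y : Fin n → Y,
      (if c.dec y ≠ some u then permKernel W (c.enc u) y else 0)
      + ∑ u : Fin M, ∑ y : Fin n → Y,
      (if c.dec y = some u then permKernel W (c.enc u) y else 0) = M := by
    rw [← Finset.sum_add_distrib]
    have : ∀ u : Fin M, ∑ y : Fin n → Y,
        (if c.dec y ≠ some u then permKernel W (c.enc u) y else 0)
        + ∑ y : Fin n → Y,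
        (if c.dec y = some u then permKernel W (c.enc u) y else 0) = 1 := by
      intro u
      rw [← Finset.sum_add_distrib, ← sum_permKernel hW (c.enc u)]
      refine Finset.sum_congr rfl fun y _ => ?_
      by_cases h : c.dec y = some u <;> simp [h]
    rw [Finset.sum_congr rfl fun u _ => this u]
    simp
  have h2 : ∑ u : Fin M, ∑ y : Fin n → Y,
      (if c.dec y = some u then permKernel W (c.enc u) y else 0)
      ≤ Fintype.card (Fin n → Y) := by
    rw [Finset.sum_comm]
    have : ∀ y : Fin n → Y, ∑ u : Fin M,
        (if c.dec y = some u then permKernel W (c.enc u) y else 0) ≤ 1 := by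
      intro y
      cases hd : c.dec y with
      | none => simp
      | some v =>
        simp only [Option.some.injEq, Finset.sum_ite_eq, Finset.mem_univ, if_true]
        exact permKernel_le_one hW _ _
    calc _ ≤ ∑ _y : Fin n → Y, (1 : ℝ) := Finset.sum_le_sum fun y _ => this y
      _ = _ := by simp
  have h3 : (M : ℝ) ≤ (Fintype.card (Fin n → Y) : ℝ) / (1 - ε) := by
    rw [le_div_iff₀ (by linarith)]
    linarith
  exact_mod_cast h3.trans (Nat.le_ceil _)

theorem one_mem_achievableSizes [Nonempty X] (W : Matrix X Y ℝ) (n : ℕ) {ε : ℝ} (hε : 0 ≤ ε) :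
    1 ∈ achievableSizes W n ε := by
  obtain ⟨x⟩ := ‹Nonempty X›
  refine ⟨le_rfl, ⟨fun _ _ => x, fun _ => some 0⟩, ?_⟩
  simpa [avgError] using hε

theorem isGreatest_Mstar [Nonempty X] {W : Matrix X Y ℝ} (hW : IsChannel W) (n : ℕ) {ε : ℝ}
    (h0 : 0 ≤ ε) (h1 : ε < 1) : IsGreatest (achievableSizes W n ε) (Mstar W n ε) :=
  ⟨Nat.sSup_mem ⟨1, one_mem_achievableSizes W n h0⟩ (bddAbove_achievableSizes hW n h1),
    fun _ h => le_csSup (bddAbove_achievableSizes hW n h1) h⟩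

end WellDefined

section Volume

variable {X Y : Type*} [Fintype Y]

theorem polytope_subset_refRegion {W : Matrix X Y ℝ} (hW : IsChannel W) :
    polytope W ⊆ refRegion W := by
  refine Set.subset_inter (subset_affineSpan ℝ _) ?_
  refine convexHull_min ?_ ?_
  · rintro _ ⟨x, rfl⟩
    exact ⟨fun y => hW.nonneg x y, hW.row_sum x⟩
  · intro p hp q hq s t hs ht hst
    refine ⟨fun y => ?_, ?_⟩
    · have := mul_nonneg hs (hp.1 y)
      have := mul_nonneg ht (hq.1 y)
      simp only [PiLp.add_apply, PiLp.smul_apply, smul_eq_mul]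
      linarith
    · simp only [PiLp.add_apply, PiLp.smul_apply, smul_eq_mul, Finset.sum_add_distrib,
        ← Finset.mul_sum, hp.2, hq.2]
      linarith

theorem isBounded_outputSimplex : Bornology.IsBounded (outputSimplex Y) := by
  rw [isBounded_iff_forall_norm_le]
  refine ⟨1, fun q hq => ?_⟩
  rw [EuclideanSpace.norm_eq, Real.sqrt_le_iff, one_pow]
  refine ⟨zero_le_one, ?_⟩
  rw [← hq.2]
  refine Finset.sum_le_sum fun y _ => ?_
  have h1 : q y ≤ 1 := hq.2 ▸ Finset.single_le_sum (fun y _ => hq.1 y) (Finset.mem_univ y)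
  rw [Real.norm_eq_abs, sq_abs]
  nlinarith [hq.1 y]

open scoped Pointwise in
/-- A bounded subset of a finite-dimensional space is contained in a simplex. -/
theorem exists_simplex_of_isBounded {V : Type*} [NormedAddCommGroup V] [NormedSpace ℝ V]
    [FiniteDimensional ℝ V] {s : Set V} (hs : Bornology.IsBounded s) :
    ∃ S : Affine.Simplex ℝ V (Module.finrank ℝ V), s ⊆ convexHull ℝ (Set.range S.points) := by
  obtain ⟨b, hb, -⟩ := exists_mem_interior_convexHull_affineBasis (Filter.univ_mem : _ ∈ nhds (0 : V))
  obtain ⟨r, hr, hball⟩ := Metric.mem_nhds_iff.1 (mem_interior_iff_mem_nhds.1 hb)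
  obtain ⟨R, hR0, hR⟩ := hs.exists_pos_norm_le
  set c : ℝ := 2 * R / r
  have hc : 0 < c := by positivity
  have hind : AffineIndependent ℝ (fun i => c • b i) := by
    have := b.ind.map' (LinearMap.toAffineMap (c • LinearMap.id : V →ₗ[ℝ] V))
      (fun x y h => by simpa [hc.ne'] using h)
    exact this
  refine ⟨⟨fun i => c • b i, hind⟩, fun x hx => ?_⟩
  have h1 : Set.range (fun i => c • b i) = c • Set.range b := by
    ext; simp [Set.mem_smul_set]
  change x ∈ convexHull ℝ (Set.range (fun i => c • b i))
  rw [h1, convexHull_smul, Set.mem_smul_set_iff_inv_smul_mem₀ hc.ne']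
  apply hball
  rw [mem_ball_zero_iff, norm_smul, norm_inv, Real.norm_of_nonneg hc.le]
  calc c⁻¹ * ‖x‖ ≤ c⁻¹ * R := by gcongr; exact hR x hx
    _ = r / 2 := by simp only [c]; field_simp
    _ < r := by linarith

theorem lambdaStar_pos [Nonempty X] {W : Matrix X Y ℝ} (hW : IsChannel W) :
    0 < lambdaStar W := by
  set A := affineSpan ℝ (polytope W) with hA
  obtain ⟨x0⟩ := ‹Nonempty X›
  set p : EuclideanSpace ℝ Y := row W x0
  have hp : p ∈ polytope W := subset_convexHull ℝ _ ⟨x0, rfl⟩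
  have hpA : p ∈ A := subset_affineSpan ℝ _ hp
  let f : A.direction →ᵃ[ℝ] EuclideanSpace ℝ Y :=
    A.direction.subtype.toAffineMap + AffineMap.const ℝ A.direction p
  have hfv : ∀ v, f v = (v : EuclideanSpace ℝ Y) + p := fun v => rfl
  have hf : Isometry f := by
    refine Isometry.of_dist_eq fun v w => ?_
    rw [hfv, hfv, dist_add_right, Subtype.dist_eq]
  have hrange : Set.range f = A := by
    ext q
    constructor
    · rintro ⟨v, rfl⟩
      exact AffineSubspace.vadd_mem_of_mem_direction v.2 hpA
    · intro hq
      exact ⟨⟨q - p, AffineSubspace.vsub_mem_direction hq hpA⟩, by simp [hfv]⟩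
  have hvol : ∀ s : Set (EuclideanSpace ℝ Y), s ⊆ A → μHE[dimP W] s = volume (f ⁻¹' s) := by
    intro s hs
    rw [← InnerProductSpace.euclideanHausdorffMeasure_eq_volume]
    have := hf.euclideanHausdorffMeasure_preimage (d := dimP W) s
    rw [hrange, Set.inter_eq_left.2 hs] at this
    exact this.symm
  -- the polytope has positive volume
  have hPA : polytope W ⊆ A := subset_affineSpan ℝ _
  have hspan : affineSpan ℝ (f ⁻¹' polytope W) = ⊤ := by
    have hmap : (affineSpan ℝ (f ⁻¹' polytope W)).map f = A := by
      rw [AffineSubspace.map_span, Set.image_preimage_eq_of_subset (by rw [hrange]; exact hPA)]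
    refine eq_top_iff.2 fun v _ => ?_
    have hv : f v ∈ (affineSpan ℝ (f ⁻¹' polytope W)).map f := by
      rw [hmap, ← SetLike.mem_coe, ← hrange]
      exact ⟨v, rfl⟩
    obtain ⟨w, hw, hwv⟩ := hv
    exact hf.injective hwv ▸ hw
  have hconv : Convex ℝ (f ⁻¹' polytope W) := (convex_convexHull ℝ _).affine_preimage f
  have hPpos : 0 < μHE[dimP W] (polytope W) := by
    rw [hvol _ hPA]
    exact Measure.measure_pos_of_nonempty_interior _
      (hconv.interior_nonempty_iff_affineSpan_eq_top.2 hspan)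
  -- some simplex of finite volume contains the reference region
  have hfin : minSimplexVol W < ⊤ := by
    have hb : Bornology.IsBounded (f ⁻¹' refRegion W) :=
      hf.antilipschitz.isBounded_preimage (isBounded_outputSimplex.subset Set.inter_subset_right)
    obtain ⟨S, hS⟩ := exists_simplex_of_isBounded hb
    have himg : convexHull ℝ (Set.range (S.map f hf.injective).points)
        = f '' convexHull ℝ (Set.range S.points) := by
      rw [AffineMap.image_convexHull, Affine.Simplex.map_points, Set.range_comp]
    have hsub : convexHull ℝ (Set.range (S.map f hf.injective).points) ⊆ A := by
      rw [himg, ← hrange]; exact Set.image_subset_range _ _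
    have hsup : refRegion W ⊆ convexHull ℝ (Set.range (S.map f hf.injective).points) := by
      rw [himg]
      intro q hq
      obtain ⟨v, rfl⟩ : q ∈ Set.range f := by rw [hrange]; exact hq.1
      exact ⟨v, hS hq, rfl⟩
    have hle : minSimplexVol W ≤
        μHE[dimP W] (convexHull ℝ (Set.range (S.map f hf.injective).points)) :=
      (iInf_le _ (S.map f hf.injective)).trans ((iInf_le _ hsup).trans (iInf_le _ hsub))
    refine hle.trans_lt ?_
    rw [hvol _ hsub, himg, Set.preimage_image_eq _ hf.injective]
    exact ((Set.finite_range S.points).isCompact_convexHull ℝ).measure_lt_top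
  have hle : μHE[dimP W] (polytope W) ≤ minSimplexVol W :=
    le_iInf fun S => le_iInf fun h => le_iInf fun _ =>
      measure_mono ((polytope_subset_refRegion hW).trans h)
  refine ENNReal.toReal_pos (ENNReal.div_pos hPpos.ne' hfin.ne).ne' ?_
  exact (ENNReal.div_lt_top (hle.trans_lt hfin).ne (hPpos.trans_le hle).ne').ne

end Volume

end NoisyPerm

end

/-! Up to a factor `n!`, the law of the output under a codeword `x` is a permanent, and by a
Cauchy–Binet formula its second moment relative to a product law `q ^ n` is the permanent of the
Gram matrix `∑ y, W(y|xᵢ) W(y|xⱼ) / q(y)`. Wick's formula writes such a permanent as a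
Gaussian integral of a product of `n` squared moduli, which the AM–GM inequality bounds by the
`n`-th power of their mean. The mean is a quadratic form whose part transverse to constants is
contracted by a factor `1 - c / 2`, where `c` bounds the entries of `W` from below, as soon as the
mean output law of `x` is within `O(1 / √n)` of `q`. Hence the second moment is bounded uniformly
in `n`.

The mean output laws lie in a polytope of dimension `d`, and a grid of `O(n ^ (d / 2))` cells of
side of order `1 / √n` supplies a suitable `q` for all of them, one for each cell. The decoding
regions of the messages are disjoint, so their total mass under each of these product laws is at
most one, and the Cauchy–Schwarz inequality bounds the number of messages by a constant times the
number of cells. -/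

noncomputable section

namespace NoisyPerm

/-! ### Permanents -/

section Permanent

open Matrix

variable {ι κ R : Type*} [Fintype ι] [DecidableEq ι] [CommSemiring R]

theorem sum_mul_card_perm [Fintype κ] (f : (ι → κ) → R) (y : ι → κ)
    [∀ z : ι → κ, DecidablePred fun σ : Equiv.Perm ι => ∀ i, y (σ i) = z i] :
    ∑ z, f z * (Finset.card {σ : Equiv.Perm ι | ∀ i, y (σ i) = z i} : R) =
      ∑ σ : Equiv.Perm ι, f (y ∘ σ) := by
  classical
  simp_rw [Finset.card_filter, Nat.cast_sum, Finset.mul_sum]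
  rw [Finset.sum_comm]
  refine Finset.sum_congr rfl fun σ _ => ?_
  have hcomp (z : ι → κ) : (∀ i, y (σ i) = z i) ↔ y ∘ σ = z := funext_iff.symm
  simp [hcomp]

theorem sum_perm_prod_comp (M : Matrix ι ι R) (σ : Equiv.Perm ι) :
    ∑ τ : Equiv.Perm ι, ∏ i, M (σ i) (τ i) = M.permanent := by
  rw [← permanent_permute_cols σ M, ← permanent_transpose]
  rfl

theorem permanent_eq_sum_prod_apply (M : Matrix ι ι R) :
    M.permanent = ∑ σ : Equiv.Perm ι, ∏ i, M i (σ i) :=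
  (sum_perm_prod_comp M 1).symm

theorem sum_permanent_mul_permanent [Fintype κ] (A : Matrix ι κ R) (B : Matrix κ ι R) :
    ∑ y : ι → κ, (A.submatrix id y).permanent * (B.submatrix y id).permanent =
      (Fintype.card ι).factorial * (A * B).permanent := by
  calc ∑ y : ι → κ, (A.submatrix id y).permanent * (B.submatrix y id).permanent
      = ∑ y : ι → κ, ∑ σ : Equiv.Perm ι, ∑ τ : Equiv.Perm ι,
          ∏ i, A (σ i) (y i) * B (y i) (τ i) := by
        refine Finset.sum_congr rfl fun y _ => ?_
        rw [permanent, permanent_eq_sum_prod_apply, Finset.sum_mul_sum]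
        simp_rw [← Finset.prod_mul_distrib, submatrix_apply, id]
    _ = ∑ σ : Equiv.Perm ι, ∑ τ : Equiv.Perm ι, ∏ i, (A * B) (σ i) (τ i) := by
        rw [Finset.sum_comm]
        refine Finset.sum_congr rfl fun σ _ => ?_
        rw [Finset.sum_comm]
        refine Finset.sum_congr rfl fun τ _ => ?_
        simp_rw [mul_apply]
        exact (Fintype.prod_sum fun i k => A (σ i) k * B k (τ i)).symm
    _ = (Fintype.card ι).factorial * (A * B).permanent := by
        simp_rw [sum_perm_prod_comp]
        simp [Fintype.card_perm]

end Permanent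

/-! ### The standard complex Gaussian measure -/

section Gaussian

open Complex ComplexConjugate

/-- The standard complex Gaussian measure on `ℂ`, with density `exp (-‖w‖²) / π`. -/
def complexGaussian : Measure ℂ :=
  volume.withDensity fun w => ENNReal.ofReal (Real.exp (-‖w‖ ^ 2) / Real.pi)

theorem integral_norm_pow_mul_exp (k : ℕ) :
    ∫ w : ℂ, ‖w‖ ^ k * Real.exp (-‖w‖ ^ 2) = Real.pi * Real.Gamma ((k + 2) / 2) := by
  have hpolar := Complex.integral_rpow_mul_exp_neg_rpow (p := 2) (q := k) one_le_two
    (by linarith [k.cast_nonneg (α := ℝ)])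
  rw [mul_div_cancel_left₀ _ (two_ne_zero' ℝ)] at hpolar
  simpa [Real.rpow_natCast] using hpolar

theorem integrable_norm_pow_mul_exp (k : ℕ) :
    Integrable fun w : ℂ => ‖w‖ ^ k * Real.exp (-‖w‖ ^ 2) := by
  -- A non-integrable function would have integral `0`.
  refine not_imp_comm.1 integral_undef ?_
  rw [integral_norm_pow_mul_exp]
  exact (mul_pos Real.pi_pos (Real.Gamma_pos_of_pos (by positivity))).ne'

theorem measurable_complexGaussian_density :
    Measurable fun w : ℂ => ENNReal.ofReal (Real.exp (-‖w‖ ^ 2) / Real.pi) := by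
  fun_prop

theorem toReal_complexGaussian_density (w : ℂ) :
    (ENNReal.ofReal (Real.exp (-‖w‖ ^ 2) / Real.pi)).toReal = Real.exp (-‖w‖ ^ 2) / Real.pi :=
  ENNReal.toReal_ofReal (by positivity)

theorem integral_complexGaussian (f : ℂ → ℂ) :
    ∫ w, f w ∂complexGaussian = ∫ w, (Real.exp (-‖w‖ ^ 2) / Real.pi) • f w := by
  rw [complexGaussian, integral_withDensity_eq_integral_toReal_smul
    measurable_complexGaussian_density (by simp)]
  simp_rw [toReal_complexGaussian_density]

theorem integral_complexGaussian_rotation (u : Circle) (f : ℂ → ℂ) :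
    ∫ w, f (u * w) ∂complexGaussian = ∫ w, f w ∂complexGaussian := by
  rw [integral_complexGaussian, integral_complexGaussian]
  simpa only [rotation_apply, norm_mul, Circle.norm_coe, one_mul] using
    (rotation u).measurePreserving.integral_comp (rotation u).toHomeomorph.measurableEmbedding
    fun w => (Real.exp (-‖w‖ ^ 2) / Real.pi) • f w

theorem integrable_complexGaussian_monomial (a b : ℕ) :
    Integrable (fun w : ℂ => w ^ a * conj w ^ b) complexGaussian := by
  rw [complexGaussian, integrable_withDensity_iff_integrable_smul'
    measurable_complexGaussian_density (by simp)]
  simp_rw [toReal_complexGaussian_density]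
  refine ((integrable_norm_pow_mul_exp (a + b)).div_const Real.pi).mono'
    (Continuous.aestronglyMeasurable (by fun_prop)) (.of_forall fun w => le_of_eq ?_)
  rw [norm_smul, Real.norm_of_nonneg (by positivity)]
  simp only [norm_mul, norm_pow, RCLike.norm_conj]
  ring

instance : IsFiniteMeasure complexGaussian := by
  have hone := integrable_complexGaussian_monomial 0 0
  simp only [pow_zero, mul_one] at hone
  exact (integrable_const_iff_isFiniteMeasure one_ne_zero).1 hone

theorem integral_complexGaussian_monomial_self (a : ℕ) :
    ∫ w, w ^ a * conj w ^ a ∂complexGaussian = a.factorial := by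
  have hradial (w : ℂ) : (Real.exp (-‖w‖ ^ 2) / Real.pi) • (w ^ a * conj w ^ a) =
      ((‖w‖ ^ (2 * a) * Real.exp (-‖w‖ ^ 2) / Real.pi : ℝ) : ℂ) := by
    rw [← mul_pow, Complex.mul_conj', Complex.real_smul, pow_mul]
    push_cast
    ring
  have hGamma : ((2 * a : ℕ) + 2 : ℝ) / 2 = a + 1 := by
    push_cast
    ring
  simp_rw [integral_complexGaussian, hradial, integral_complex_ofReal, integral_div,
    integral_norm_pow_mul_exp, hGamma, Real.Gamma_nat_eq_factorial,
    mul_div_cancel_left₀ _ Real.pi_ne_zero, Complex.ofReal_natCast]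

theorem integral_complexGaussian_monomial_of_ne {a b : ℕ} (hab : a ≠ b) :
    ∫ w, w ^ a * conj w ^ b ∂complexGaussian = 0 := by
  have hab' : (a : ℂ) - b ≠ 0 := sub_ne_zero.2 (Nat.cast_injective.ne hab)
  -- The rotation by the angle `π / (a - b)` multiplies the monomial by `-1`.
  let θ : ℝ := Real.pi / (a - b)
  have hcoef : (Circle.exp θ : ℂ) ^ a * conj (Circle.exp θ : ℂ) ^ b = -1 := by
    rw [Circle.coe_exp, ← Complex.exp_conj, ← Complex.exp_nat_mul, ← Complex.exp_nat_mul,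
      ← Complex.exp_add, ← Complex.exp_pi_mul_I]
    congr 1
    simp only [θ, map_mul, conj_ofReal, conj_I]
    push_cast
    field_simp
    ring
  have hneg (w : ℂ) : (Circle.exp θ * w) ^ a * conj (Circle.exp θ * w) ^ b =
      -(w ^ a * conj w ^ b) := by
    rw [map_mul, mul_pow, mul_pow, mul_mul_mul_comm, hcoef, neg_one_mul]
  have hrot := integral_complexGaussian_rotation (Circle.exp θ) fun w => w ^ a * conj w ^ b
  simp_rw [hneg, integral_neg] at hrot
  exact self_eq_neg.1 hrot.symm

end Gaussian

/-! ### Moments of complex Gaussian vectors -/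

section GaussianVector

open ComplexConjugate

variable {κ : Type*} [Fintype κ]

/-- The law of a vector of independent standard complex Gaussians. -/
def gaussianVec (κ : Type*) [Fintype κ] : Measure (κ → ℂ) :=
  Measure.pi fun _ => complexGaussian

theorem integrable_gaussianVec_monomial (s t : κ → ℕ) :
    Integrable (fun w : κ → ℂ => ∏ k, (w k ^ s k * conj (w k) ^ t k)) (gaussianVec κ) :=
  Integrable.fintype_prod (f := fun k (w : ℂ) => w ^ s k * conj w ^ t k)
    fun _ => integrable_complexGaussian_monomial _ _

theorem integral_gaussianVec_monomial (s t : κ → ℕ) :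
    ∫ w, ∏ k, (w k ^ s k * conj (w k) ^ t k) ∂gaussianVec κ =
      if s = t then ∏ k, ((s k).factorial : ℂ) else 0 := by
  rw [gaussianVec, integral_fintype_prod_eq_prod (fun k (w : ℂ) => w ^ s k * conj w ^ t k)]
  split_ifs with hst
  · simp_rw [hst, integral_complexGaussian_monomial_self]
  · obtain ⟨k, hk⟩ := Function.ne_iff.1 hst
    exact Finset.prod_eq_zero (Finset.mem_univ k) (integral_complexGaussian_monomial_of_ne hk)

theorem prod_pow_mul_conj_pow_eq_ofReal (s : κ → ℕ) (w : κ → ℂ) :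
    ∏ k, (w k ^ s k * conj (w k) ^ s k) = ((∏ k, (‖w k‖ ^ 2) ^ s k : ℝ) : ℂ) := by
  simp_rw [← mul_pow, Complex.mul_conj']
  push_cast
  rfl

theorem integrable_prod_norm_sq_pow (s : κ → ℕ) :
    Integrable (fun w : κ → ℂ => ∏ k, (‖w k‖ ^ 2) ^ s k) (gaussianVec κ) := by
  have h := (integrable_gaussianVec_monomial s s).re
  simp_rw [prod_pow_mul_conj_pow_eq_ofReal] at h
  exact h

theorem integral_prod_norm_sq_pow (s : κ → ℕ) :
    ∫ w, ∏ k, (‖w k‖ ^ 2) ^ s k ∂gaussianVec κ = ∏ k, ((s k).factorial : ℝ) := by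
  have h := integral_gaussianVec_monomial s s
  simp_rw [prod_pow_mul_conj_pow_eq_ofReal, integral_complex_ofReal, if_true] at h
  exact_mod_cast h

theorem weighted_sum_norm_sq_pow_eq [DecidableEq κ] (c : κ → ℝ) (n : ℕ) (w : κ → ℂ) :
    (∑ k, c k * ‖w k‖ ^ 2) ^ n =
      ∑ s ∈ Finset.piAntidiag Finset.univ n,
        (Nat.multinomial Finset.univ s * ∏ k, c k ^ s k) * ∏ k, (‖w k‖ ^ 2) ^ s k := by
  rw [Finset.sum_pow_eq_sum_piAntidiag]
  simp_rw [mul_pow, Finset.prod_mul_distrib, mul_assoc]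

theorem integrable_weighted_sum_norm_sq_pow (c : κ → ℝ) (n : ℕ) :
    Integrable (fun w : κ → ℂ => (∑ k, c k * ‖w k‖ ^ 2) ^ n) (gaussianVec κ) := by
  classical
  simp_rw [weighted_sum_norm_sq_pow_eq]
  exact integrable_finsetSum _ fun s _ => (integrable_prod_norm_sq_pow s).const_mul _

theorem integral_weighted_sum_norm_sq_pow [DecidableEq κ] (c : κ → ℝ) (n : ℕ) :
    ∫ w, (∑ k, c k * ‖w k‖ ^ 2) ^ n ∂gaussianVec κ =
      n.factorial * ∑ s ∈ Finset.piAntidiag Finset.univ n, ∏ k, c k ^ s k := by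
  simp_rw [weighted_sum_norm_sq_pow_eq]
  rw [integral_finsetSum _ fun s _ => (integrable_prod_norm_sq_pow s).const_mul _, Finset.mul_sum]
  refine Finset.sum_congr rfl fun s hs => ?_
  have hmult := Nat.multinomial_spec Finset.univ s
  rw [(Finset.mem_piAntidiag.1 hs).1] at hmult
  rw [integral_const_mul, integral_prod_norm_sq_pow, ← hmult]
  push_cast
  ring

end GaussianVector

/-! ### Wick's formula -/

section WordType

variable {ι κ : Type*} [Fintype ι] [DecidableEq κ]

/-- The number of occurrences of each symbol in a word; `ι` is the set of positions. -/
def wordType (z : ι → κ) (k : κ) : ℕ :=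
  Fintype.card {i // z i = k}

theorem wordType_comp_perm (z : ι → κ) (σ : Equiv.Perm ι) : wordType (z ∘ σ) = wordType z :=
  funext fun _ => Fintype.card_congr (σ.subtypeEquiv fun _ => Iff.rfl)

theorem exists_perm_of_wordType_eq {y z : ι → κ} (h : wordType y = wordType z) :
    ∃ σ : Equiv.Perm ι, y ∘ σ = z := by
  have e (k : κ) : {i // z i = k} ≃ {i // y i = k} := Fintype.equivOfCardEq (congrFun h.symm k)
  refine ⟨(Equiv.sigmaFiberEquiv z).symm.trans
    ((Equiv.sigmaCongrRight e).trans (Equiv.sigmaFiberEquiv y)), ?_⟩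
  funext i
  exact (e (z i) ⟨i, rfl⟩).2

theorem prod_comp_eq_prod_pow_wordType [Fintype κ] {R : Type*} [CommMonoid R] (z : ι → κ)
    (f : κ → R) : ∏ i, f (z i) = ∏ k, f k ^ wordType z k := by
  rw [← Finset.prod_fiberwise' Finset.univ z f]
  simp_rw [Finset.prod_const, wordType, Fintype.card_subtype]

theorem card_perm_comp_eq [Fintype κ] [DecidableEq ι] (y z : ι → κ) :
    Finset.card {σ : Equiv.Perm ι | ∀ i, y (σ i) = z i} =
      if wordType y = wordType z then ∏ k, (wordType y k).factorial else 0 := by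
  split_ifs with h
  · obtain ⟨τ, rfl⟩ := exists_perm_of_wordType_eq h
    simp only [wordType]
    rw [← DomMulAct.stabilizer_card y, Fintype.card_subtype]
    refine Finset.card_equiv (Equiv.mulRight τ⁻¹) fun σ => ?_
    simp only [Finset.mem_filter, Finset.mem_univ, true_and, funext_iff, Function.comp_apply,
      Equiv.coe_mulRight, Equiv.Perm.mul_apply]
    exact τ.forall_congr fun i => by simp
  · refine Finset.card_eq_zero.2 (Finset.filter_eq_empty_iff.2 fun σ _ hσ => h ?_)
    rw [← wordType_comp_perm y σ]
    exact congrArg wordType (funext hσ)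

end WordType

section Wick

open ComplexConjugate Matrix

variable {ι κ : Type*} [Fintype ι] [Fintype κ]

theorem prod_mul_conj_prod_eq_monomial [DecidableEq κ] (y z : ι → κ) (w : κ → ℂ) :
    (∏ i, w (y i)) * conj (∏ i, w (z i)) =
      ∏ k, (w k ^ wordType y k * conj (w k) ^ wordType z k) := by
  rw [map_prod, prod_comp_eq_prod_pow_wordType y,
    prod_comp_eq_prod_pow_wordType z fun k => conj (w k), Finset.prod_mul_distrib]

theorem integrable_gaussianVec_words (y z : ι → κ) :
    Integrable (fun w : κ → ℂ => (∏ i, w (y i)) * conj (∏ i, w (z i))) (gaussianVec κ) := by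
  classical
  simp_rw [prod_mul_conj_prod_eq_monomial]
  exact integrable_gaussianVec_monomial _ _

theorem integral_gaussianVec_words [DecidableEq ι] [DecidableEq κ] (y z : ι → κ) :
    ∫ w, (∏ i, w (y i)) * conj (∏ i, w (z i)) ∂gaussianVec κ =
      (Finset.card {σ : Equiv.Perm ι | ∀ i, y (σ i) = z i} : ℂ) := by
  simp_rw [prod_mul_conj_prod_eq_monomial]
  rw [integral_gaussianVec_monomial, card_perm_comp_eq]
  push_cast
  rfl

theorem prod_mulVec_mul_conj_eq_sum [DecidableEq ι] (A B : Matrix ι κ ℂ) (w : κ → ℂ) :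
    (∏ i, (A *ᵥ w) i) * conj (∏ i, (B *ᵥ w) i) =
      ∑ y : ι → κ, ∑ z : ι → κ, (∏ i, A i (y i)) * conj (∏ i, B i (z i)) *
        ((∏ i, w (y i)) * conj (∏ i, w (z i))) := by
  simp_rw [mulVec, dotProduct, Fintype.prod_sum, map_sum, Finset.sum_mul_sum,
    Finset.prod_mul_distrib, map_mul]
  refine Finset.sum_congr rfl fun y _ => Finset.sum_congr rfl fun z _ => ?_
  ring

theorem integrable_prod_mulVec_mul_conj (A B : Matrix ι κ ℂ) :
    Integrable (fun w => (∏ i, (A *ᵥ w) i) * conj (∏ i, (B *ᵥ w) i)) (gaussianVec κ) := by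
  classical
  simp_rw [prod_mulVec_mul_conj_eq_sum]
  exact integrable_finsetSum _ fun y _ => integrable_finsetSum _ fun z _ =>
    (integrable_gaussianVec_words y z).const_mul _

theorem permanent_mul_conjTranspose_eq_sum [DecidableEq ι] (A B : Matrix ι κ ℂ) :
    (A * Bᴴ).permanent =
      ∑ y : ι → κ, ∑ σ : Equiv.Perm ι, (∏ i, A i (y i)) * conj (∏ i, B i (y (σ i))) := by
  rw [permanent, Finset.sum_comm]
  refine Finset.sum_congr rfl fun σ _ => ?_
  calc ∏ i, (A * Bᴴ) (σ i) i = ∑ y : ι → κ, ∏ i, A (σ i) (y i) * conj (B i (y i)) := by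
        simp_rw [mul_apply, conjTranspose_apply]
        exact Fintype.prod_sum fun i k => A (σ i) k * conj (B i k)
    _ = ∑ y : ι → κ, ∏ i, A (σ i) (y (σ i)) * conj (B i (y (σ i))) :=
        (Equiv.sum_comp (σ.symm.arrowCongr (Equiv.refl κ))
          fun y => ∏ i, A (σ i) (y i) * conj (B i (y i))).symm
    _ = ∑ y : ι → κ, (∏ i, A i (y i)) * conj (∏ i, B i (y (σ i))) := by
        refine Finset.sum_congr rfl fun y _ => ?_
        rw [Finset.prod_mul_distrib, Equiv.prod_comp σ fun i => A i (y i), map_prod]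

theorem integral_prod_mulVec_mul_conj [DecidableEq ι] (A B : Matrix ι κ ℂ) :
    ∫ w, (∏ i, (A *ᵥ w) i) * conj (∏ i, (B *ᵥ w) i) ∂gaussianVec κ = (A * Bᴴ).permanent := by
  classical
  simp_rw [prod_mulVec_mul_conj_eq_sum]
  rw [integral_finsetSum _ fun y _ => integrable_finsetSum _ fun z _ =>
    (integrable_gaussianVec_words y z).const_mul _, permanent_mul_conjTranspose_eq_sum]
  refine Finset.sum_congr rfl fun y _ => ?_
  simp_rw [integral_finsetSum _ fun z _ => (integrable_gaussianVec_words y z).const_mul _,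
    integral_const_mul, integral_gaussianVec_words]
  exact sum_mul_card_perm (fun z => (∏ i, A i (y i)) * conj (∏ i, B i (z i))) y

end Wick

/-! ### Permanents of Gram matrices -/

section GramPermanent

open ComplexConjugate Matrix

theorem prod_le_mean_pow {ι : Type*} [Fintype ι] {t : ι → ℝ} (ht : ∀ i, 0 ≤ t i) :
    ∏ i, t i ≤ ((∑ i, t i) / Fintype.card ι) ^ Fintype.card ι := by
  rcases isEmpty_or_nonempty ι with _ | _
  · simp
  have hcard : (Fintype.card ι : ℝ) ≠ 0 := Nat.cast_ne_zero.2 Fintype.card_ne_zero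
  have hmean := Real.geom_mean_le_arith_mean_weighted Finset.univ
    (fun _ => (Fintype.card ι : ℝ)⁻¹) t (fun _ _ => by positivity) (by simp [hcard])
    fun i _ => ht i
  rw [← Finset.mul_sum, ← div_eq_inv_mul] at hmean
  calc ∏ i, t i = (∏ i, t i ^ (Fintype.card ι : ℝ)⁻¹) ^ Fintype.card ι := by
        rw [← Finset.prod_pow]
        exact Finset.prod_congr rfl fun i _ =>
          (Real.rpow_inv_natCast_pow (ht i) Fintype.card_ne_zero).symm
    _ ≤ _ := pow_le_pow_left₀ (Finset.prod_nonneg fun i _ => Real.rpow_nonneg (ht i) _) hmean _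

variable {ι κ : Type*} [Fintype ι] [Fintype κ]

theorem prod_norm_sq_mulVec_eq_ofReal (A : Matrix ι κ ℂ) (w : κ → ℂ) :
    (∏ i, (A *ᵥ w) i) * conj (∏ i, (A *ᵥ w) i) = ((∏ i, ‖(A *ᵥ w) i‖ ^ 2 : ℝ) : ℂ) := by
  rw [Complex.mul_conj', norm_prod, Finset.prod_pow]
  norm_cast

theorem integrable_prod_norm_sq_mulVec (A : Matrix ι κ ℂ) :
    Integrable (fun w => ∏ i, ‖(A *ᵥ w) i‖ ^ 2) (gaussianVec κ) := by
  have h := (integrable_prod_mulVec_mul_conj A A).re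
  simp_rw [prod_norm_sq_mulVec_eq_ofReal] at h
  exact h

theorem integral_prod_norm_sq_mulVec [DecidableEq ι] (A : Matrix ι κ ℝ) :
    ∫ w, ∏ i, ‖(A.map Complex.ofReal *ᵥ w) i‖ ^ 2 ∂gaussianVec κ = (A * Aᵀ).permanent := by
  have h := integral_prod_mulVec_mul_conj (A.map Complex.ofReal) (A.map Complex.ofReal)
  simp_rw [prod_norm_sq_mulVec_eq_ofReal, integral_complex_ofReal] at h
  have hmap : A.map Complex.ofReal * (A.map Complex.ofReal)ᴴ
      = (A * Aᵀ).map Complex.ofReal := by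
    ext i j
    simp [mul_apply]
  rw [hmap] at h
  simp only [permanent, map_apply] at h ⊢
  exact_mod_cast h

theorem permanent_mul_transpose_le [DecidableEq ι] [DecidableEq κ] (A : Matrix ι κ ℝ) {c : κ → ℝ}
    (hA : ∀ w : κ → ℂ, (∑ i, ‖(A.map Complex.ofReal *ᵥ w) i‖ ^ 2) / Fintype.card ι
      ≤ ∑ k, c k * ‖w k‖ ^ 2) :
    (A * Aᵀ).permanent ≤ (Fintype.card ι).factorial *
      ∑ s ∈ Finset.piAntidiag Finset.univ (Fintype.card ι), ∏ k, c k ^ s k := by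
  rw [← integral_prod_norm_sq_mulVec, ← integral_weighted_sum_norm_sq_pow]
  refine integral_mono (integrable_prod_norm_sq_mulVec _)
    (integrable_weighted_sum_norm_sq_pow _ _) fun w => ?_
  exact (prod_le_mean_pow fun i => by positivity).trans
    (pow_le_pow_left₀ (by positivity) (hA w) _)

theorem sum_piAntidiag_option_le {Y : Type*} [Fintype Y] [DecidableEq Y] {f : (Y → ℕ) → ℝ}
    (hf : ∀ r, 0 ≤ f r) (n : ℕ) :
    ∑ s ∈ Finset.piAntidiag (Finset.univ : Finset (Option Y)) n, f (s ∘ some) ≤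
      ∑ r ∈ Fintype.piFinset fun _ : Y => Finset.range (n + 1), f r := by
  have hinj : Set.InjOn (fun s : Option Y → ℕ => s ∘ some)
      (Finset.piAntidiag (Finset.univ : Finset (Option Y)) n) := by
    intro s hs t ht hst
    have hsum := (Finset.mem_piAntidiag.1 hs).1.trans (Finset.mem_piAntidiag.1 ht).1.symm
    have hsome (y : Y) : s (some y) = t (some y) := congrFun hst y
    simp_rw [Fintype.sum_option, hsome, add_left_inj] at hsum
    funext k
    cases k with
    | none => exact hsum
    | some y => exact hsome y
  rw [← Finset.sum_image (f := f) hinj]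
  refine Finset.sum_le_sum_of_subset_of_nonneg (Finset.image_subset_iff.2 fun s hs => ?_)
    fun r _ _ => hf r
  simp only [Fintype.mem_piFinset, Finset.mem_range, Nat.lt_succ_iff]
  intro y
  rw [← (Finset.mem_piAntidiag.1 hs).1]
  exact Finset.single_le_sum (f := s) (fun _ _ => Nat.zero_le _) (Finset.mem_univ _)

theorem sum_piAntidiag_prod_option_le {Y : Type*} [Fintype Y] [DecidableEq Y] {ρ : ℝ}
    (hρ0 : 0 ≤ ρ) (hρ1 : ρ < 1) {K : ℝ} (hK : 0 ≤ K) (n : ℕ) :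
    ∑ s ∈ Finset.piAntidiag (Finset.univ : Finset (Option Y)) n,
        ∏ k, (K * k.elim 1 fun _ => ρ) ^ s k ≤ K ^ n * (1 - ρ)⁻¹ ^ Fintype.card Y := by
  calc ∑ s ∈ Finset.piAntidiag (Finset.univ : Finset (Option Y)) n,
        ∏ k, (K * k.elim 1 fun _ => ρ) ^ s k
      = K ^ n * ∑ s ∈ Finset.piAntidiag (Finset.univ : Finset (Option Y)) n,
          ∏ y, ρ ^ (s ∘ some) y := by
        rw [Finset.mul_sum]
        refine Finset.sum_congr rfl fun s hs => ?_
        simp_rw [mul_pow, Finset.prod_mul_distrib, Finset.prod_pow_eq_pow_sum,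
          (Finset.mem_piAntidiag.1 hs).1, Fintype.prod_option, Option.elim, one_pow, one_mul,
          Finset.prod_pow_eq_pow_sum, Function.comp_apply]
    _ ≤ K ^ n * ∑ r ∈ Fintype.piFinset fun _ : Y => Finset.range (n + 1), ∏ y, ρ ^ r y := by
        gcongr
        exact sum_piAntidiag_option_le
          (fun r : Y → ℕ => Finset.prod_nonneg fun y _ => pow_nonneg hρ0 (r y)) n
    _ = K ^ n * (∑ r ∈ Finset.range (n + 1), ρ ^ r) ^ Fintype.card Y := by
        rw [Finset.sum_prod_piFinset _ fun _ r => ρ ^ r, Finset.prod_const, Finset.card_univ]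
    _ ≤ K ^ n * (1 - ρ)⁻¹ ^ Fintype.card Y := by
        gcongr
        rw [← tsum_geometric_of_lt_one hρ0 hρ1]
        exact (summable_geometric_of_lt_one hρ0 hρ1).sum_le_tsum _ fun r _ => pow_nonneg hρ0 r

theorem permanent_one_add_gram_le [DecidableEq ι] {Y : Type*} [Fintype Y] (u : Matrix ι Y ℝ)
    {ρ : ℝ} (hρ0 : 0 ≤ ρ) (hρ1 : ρ < 1) {K : ℝ} (hK : 0 ≤ K)
    (hu : ∀ (μ : ℂ) (w : Y → ℂ), (∑ i, ‖μ + ∑ y, (u i y : ℂ) * w y‖ ^ 2) / Fintype.card ι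
      ≤ K * (‖μ‖ ^ 2 + ρ * ∑ y, ‖w y‖ ^ 2)) :
    (of fun i j => 1 + ∑ y, u i y * u j y).permanent ≤
      (Fintype.card ι).factorial * (K ^ Fintype.card ι * (1 - ρ)⁻¹ ^ Fintype.card Y) := by
  classical
  let A : Matrix ι (Option Y) ℝ := of fun i k => k.elim 1 (u i)
  have hA : A * Aᵀ = of fun i j => 1 + ∑ y, u i y * u j y := by
    ext i j
    simp [A, mul_apply, Fintype.sum_option]
  rw [← hA]
  refine (permanent_mul_transpose_le A fun w => ?_).trans
    (mul_le_mul_of_nonneg_left (sum_piAntidiag_prod_option_le hρ0 hρ1 hK _) (by positivity))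
  convert hu (w none) fun y => w (some y) using 1
  · simp [A, mulVec, dotProduct, Fintype.sum_option]
  · simp [Fintype.sum_option, Finset.mul_sum, mul_add, mul_assoc]

end GramPermanent

/-! ### The second moment of the likelihood ratio as a permanent -/

section LikelihoodRatio

open Matrix

variable {X Y : Type*} [Fintype Y]

theorem permKernel_eq_permanent_div [DecidableEq Y] (W : Matrix X Y ℝ) {n : ℕ} (x : Fin n → X)
    (y : Fin n → Y) : permKernel W x y = (W.submatrix x y).permanent / n.factorial := by
  simp_rw [permKernel, permBlock, ← mul_div_assoc]
  rw [← Finset.sum_div, sum_mul_card_perm (dmcLaw W x), permanent_eq_sum_prod_apply]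
  rfl

theorem permanent_submatrix_div_prod {ι Y R : Type*} [Fintype ι] [DecidableEq ι] [Field R]
    (P : Matrix ι Y R) (q : Y → R) (y : ι → Y) :
    ((of fun k i => P i k / q k).submatrix y id).permanent =
      (P.submatrix id y).permanent / ∏ i, q (y i) := by
  rw [permanent_eq_sum_prod_apply, permanent, Finset.sum_div]
  simp_rw [← Finset.prod_div_distrib]
  rfl

theorem sum_sq_permKernel_div_prod_eq [DecidableEq Y] (W : Matrix X Y ℝ) {n : ℕ}
    (x : Fin n → X) (q : Y → ℝ) :
    ∑ y : Fin n → Y, permKernel W x y ^ 2 / ∏ i, q (y i) =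
      (of fun i j => ∑ k, W (x i) k * W (x j) k / q k).permanent / n.factorial := by
  have hCB := sum_permanent_mul_permanent (W.submatrix x id)
    (of fun k i => W.submatrix x id i k / q k)
  simp_rw [permanent_submatrix_div_prod, submatrix_submatrix, Function.comp_id,
    Function.id_comp, Fintype.card_fin] at hCB
  have hmul : W.submatrix x id * (of fun k i => W.submatrix x id i k / q k) =
      of fun i j => ∑ k, W (x i) k * W (x j) k / q k := by
    ext i j
    simp [mul_apply, mul_div_assoc]
  rw [hmul] at hCB
  have hfac : (n.factorial : ℝ) ≠ 0 := by positivity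
  rw [← mul_div_mul_left _ _ hfac, ← hCB, Finset.sum_div]
  refine Finset.sum_congr rfl fun y _ => ?_
  rw [permKernel_eq_permanent_div]
  ring

theorem sum_mul_div_eq_one_add {p p' q : Y → ℝ} (hq : ∀ y, 0 < q y)
    (hp1 : ∑ y, p y = 1) (hp'1 : ∑ y, p' y = 1) (hq1 : ∑ y, q y = 1) :
    ∑ y, p y * p' y / q y = 1 + ∑ y, (p y - q y) / √(q y) * ((p' y - q y) / √(q y)) := by
  have hterm (y : Y) : (p y - q y) / √(q y) * ((p' y - q y) / √(q y)) =
      p y * p' y / q y - p y - p' y + q y := by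
    rw [div_mul_div_comm, Real.mul_self_sqrt (hq y).le]
    field_simp [(hq y).ne']
    ring
  simp_rw [hterm, Finset.sum_add_distrib, Finset.sum_sub_distrib, hp1, hp'1, hq1]
  ring

end LikelihoodRatio

/-! ### The quadratic form of a codeword -/

section QuadraticForm

variable {Y E : Type*} [Fintype Y]

theorem norm_sum_smul_sq_le [SeminormedAddCommGroup E] [NormedSpace ℝ E] {p : Y → ℝ}
    (hp : ∀ y, 0 ≤ p y) (g : Y → E) :
    ‖∑ y, p y • g y‖ ^ 2 ≤ (∑ y, p y) * ∑ y, p y * ‖g y‖ ^ 2 := by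
  have hnorm : ‖∑ y, p y • g y‖ ≤ ∑ y, p y * ‖g y‖ := by
    refine (norm_sum_le _ _).trans (Finset.sum_le_sum fun y _ => ?_)
    rw [norm_smul, Real.norm_of_nonneg (hp y)]
  refine (pow_le_pow_left₀ (norm_nonneg _) hnorm 2).trans ?_
  exact Finset.sum_sq_le_sum_mul_sum_of_sq_le_mul _ (fun y _ => hp y)
    (fun y _ => mul_nonneg (hp y) (by positivity)) fun y _ => le_of_eq (by ring)

theorem norm_sum_smul_sq_le_sum_sq_mul [SeminormedAddCommGroup E] [NormedSpace ℝ E]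
    (p : Y → ℝ) (g : Y → E) :
    ‖∑ y, p y • g y‖ ^ 2 ≤ (∑ y, p y ^ 2) * ∑ y, ‖g y‖ ^ 2 := by
  have hnorm : ‖∑ y, p y • g y‖ ≤ ∑ y, |p y| * ‖g y‖ :=
    (norm_sum_le _ _).trans (Finset.sum_le_sum fun y _ => (norm_smul _ _).le)
  refine (pow_le_pow_left₀ (norm_nonneg _) hnorm 2).trans ?_
  simpa only [sq_abs] using Finset.sum_mul_sq_le_sq_mul_sq Finset.univ (|p ·|) (‖g ·‖)

variable [NormedAddCommGroup E] [InnerProductSpace ℝ E]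

theorem sum_mul_norm_sub_mean_sq_le {q : Y → ℝ} (hq1 : ∑ y, q y = 1) (g : Y → E) :
    ∑ y, q y * ‖g y - ∑ k, q k • g k‖ ^ 2 ≤ ∑ y, q y * ‖g y‖ ^ 2 := by
  set m := ∑ k, q k • g k with hm
  have hterm (y : Y) : q y * ‖g y - m‖ ^ 2 =
      q y * ‖g y‖ ^ 2 - 2 * inner ℝ (q y • g y) m + q y * ‖m‖ ^ 2 := by
    rw [norm_sub_sq_real, real_inner_smul_left]
    ring
  simp_rw [hterm, Finset.sum_add_distrib, Finset.sum_sub_distrib]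
  rw [← Finset.mul_sum, ← sum_inner, ← Finset.sum_mul, hq1, ← hm, real_inner_self_eq_norm_sq]
  linarith [sq_nonneg ‖m‖]

theorem norm_sum_sub_smul_sq_le {p q : Y → ℝ} {c : ℝ} (hp1 : ∑ y, p y = 1)
    (hq1 : ∑ y, q y = 1) (hcq : ∀ y, c * q y ≤ p y) (g : Y → E) :
    ‖∑ y, (p y - q y) • g y‖ ^ 2 ≤
      (1 - c) * ∑ y, (p y - c * q y) * ‖g y - ∑ k, q k • g k‖ ^ 2 := by
  set m := ∑ k, q k • g k with hm
  have hcentre : ∑ y, (p y - q y) • g y = ∑ y, (p y - c * q y) • (g y - m) := by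
    simp_rw [smul_sub, sub_smul, Finset.sum_sub_distrib, ← Finset.sum_smul,
      ← Finset.mul_sum, mul_smul, ← Finset.smul_sum, hp1, hq1, ← hm]
    module
  have hmass : ∑ y, (p y - c * q y) = 1 - c := by
    rw [Finset.sum_sub_distrib, ← Finset.mul_sum, hp1, hq1, mul_one]
  rw [hcentre, ← hmass]
  exact norm_sum_smul_sq_le (fun y => sub_nonneg.2 (hcq y)) _

variable {ι : Type*} [Fintype ι] [Nonempty ι]

theorem mean_norm_add_sq_le (μ : E) (h : ι → E) :
    (∑ i, ‖μ + h i‖ ^ 2) / Fintype.card ι ≤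
      (1 + 1 / Fintype.card ι) * ‖μ‖ ^ 2
        + Fintype.card ι * ‖(Fintype.card ι : ℝ)⁻¹ • ∑ i, h i‖ ^ 2
        + (∑ i, ‖h i‖ ^ 2) / Fintype.card ι := by
  set n : ℝ := (Fintype.card ι : ℝ)
  have hn : 0 < n := Nat.cast_pos.2 Fintype.card_pos
  set m : E := n⁻¹ • ∑ i, h i with hm
  have hexpand : (∑ i, ‖μ + h i‖ ^ 2) / n =
      ‖μ‖ ^ 2 + 2 * inner ℝ μ m + (∑ i, ‖h i‖ ^ 2) / n := by
    simp_rw [norm_add_sq_real, Finset.sum_add_distrib, ← Finset.mul_sum, ← inner_sum, hm,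
      real_inner_smul_right, Finset.sum_const, Finset.card_univ, nsmul_eq_mul]
    change (n * _ + _ + _) / n = _
    field_simp
  -- AM-GM with weights `1 / n` and `n`: the mean `m` is as small as `1 / √n`
  have hcross : 2 * inner ℝ μ m ≤ 1 / n * ‖μ‖ ^ 2 + n * ‖m‖ ^ 2 := by
    have hsq : 1 / n * ‖μ‖ ^ 2 + n * ‖m‖ ^ 2 - 2 * (‖μ‖ * ‖m‖) = (‖μ‖ - n * ‖m‖) ^ 2 / n := by
      field_simp
      ring
    have : 0 ≤ (‖μ‖ - n * ‖m‖) ^ 2 / n := by positivity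
    linarith [real_inner_le_norm μ m]
  rw [hexpand]
  linarith

/-- The average of the rows of `P`. For the rows `W(·|xᵢ)` selected by a codeword `x` it is the
expected type of the channel output. -/
def meanRow (P : Matrix ι Y ℝ) (y : Y) : ℝ :=
  (∑ i, P i y) / Fintype.card ι

theorem mean_norm_sum_sub_smul_sq_le {P : Matrix ι Y ℝ} {q : Y → ℝ} {c : ℝ} (hc : c ≤ 1)
    (hP1 : ∀ i, ∑ y, P i y = 1) (hq1 : ∑ y, q y = 1)
    (hcP : ∀ i y, c * q y ≤ P i y) (hmean : ∀ y, meanRow P y ≤ (1 + c) * q y) (g : Y → E) :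
    (∑ i, ‖∑ y, (P i y - q y) • g y‖ ^ 2) / Fintype.card ι ≤
      (1 - c) * ∑ y, q y * ‖g y‖ ^ 2 := by
  have hn : (Fintype.card ι : ℝ) ≠ 0 := Nat.cast_ne_zero.2 Fintype.card_ne_zero
  set m := ∑ k, q k • g k
  calc (∑ i, ‖∑ y, (P i y - q y) • g y‖ ^ 2) / Fintype.card ι
      ≤ (∑ i, (1 - c) * ∑ y, (P i y - c * q y) * ‖g y - m‖ ^ 2) / Fintype.card ι := by
        gcongr with i
        exact norm_sum_sub_smul_sq_le (hP1 i) hq1 (hcP i) g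
    _ = (1 - c) * ∑ y, (meanRow P y - c * q y) * ‖g y - m‖ ^ 2 := by
        rw [← Finset.mul_sum, Finset.sum_comm, mul_div_assoc, Finset.sum_div]
        congr 1
        refine Finset.sum_congr rfl fun y _ => ?_
        rw [← Finset.sum_mul, Finset.sum_sub_distrib, meanRow]
        simp only [Finset.sum_const, Finset.card_univ, nsmul_eq_mul]
        field_simp
    _ ≤ (1 - c) * ∑ y, q y * ‖g y - m‖ ^ 2 := by
        gcongr with y
        linarith [hmean y]
    _ ≤ (1 - c) * ∑ y, q y * ‖g y‖ ^ 2 :=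
        mul_le_mul_of_nonneg_left (sum_mul_norm_sub_mean_sq_le hq1 g) (by linarith)

theorem inv_card_smul_sum_sum_sub_smul (P : Matrix ι Y ℝ) (q : Y → ℝ) (g : Y → E) :
    (Fintype.card ι : ℝ)⁻¹ • ∑ i, ∑ y, (P i y - q y) • g y =
      ∑ y, (meanRow P y - q y) • g y := by
  have hn : (Fintype.card ι : ℝ) ≠ 0 := Nat.cast_ne_zero.2 Fintype.card_ne_zero
  rw [Finset.sum_comm, Finset.smul_sum]
  refine Finset.sum_congr rfl fun y _ => ?_
  rw [← Finset.sum_smul, smul_smul, Finset.sum_sub_distrib, meanRow]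
  congr 1
  simp only [Finset.sum_const, Finset.card_univ, nsmul_eq_mul]
  field_simp

theorem card_mul_norm_sq_sum_meanRow_sub_smul_le {P : Matrix ι Y ℝ} {q : Y → ℝ} {c : ℝ}
    (hc0 : 0 < c) (hc1 : c ≤ 1) (hcq : ∀ y, c ≤ q y)
    (hmean : ∑ y, (meanRow P y - q y) ^ 2 ≤ c ^ 4 / (2 * Fintype.card ι)) (g : Y → E) :
    Fintype.card ι * ‖∑ y, (meanRow P y - q y) • g y‖ ^ 2 ≤ c / 2 * ∑ y, q y * ‖g y‖ ^ 2 := by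
  have : (0 : ℝ) < Fintype.card ι := Nat.cast_pos.2 Fintype.card_pos
  have hg : c * ∑ y, ‖g y‖ ^ 2 ≤ ∑ y, q y * ‖g y‖ ^ 2 := by
    rw [Finset.mul_sum]
    gcongr with y
    exact hcq y
  calc Fintype.card ι * ‖∑ y, (meanRow P y - q y) • g y‖ ^ 2
      ≤ Fintype.card ι * (c ^ 4 / (2 * Fintype.card ι) * ∑ y, ‖g y‖ ^ 2) := by
        gcongr
        exact (norm_sum_smul_sq_le_sum_sq_mul _ g).trans
          (mul_le_mul_of_nonneg_right hmean (by positivity))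
    _ = c ^ 3 / 2 * (c * ∑ y, ‖g y‖ ^ 2) := by field_simp
    _ ≤ c / 2 * ∑ y, q y * ‖g y‖ ^ 2 := by
        gcongr
        exact pow_le_of_le_one hc0.le hc1 (by norm_num)

theorem meanRow_le_one_add_mul {P : Matrix ι Y ℝ} {q : Y → ℝ} {c : ℝ} (hc : 0 ≤ c)
    (hcq : ∀ y, c ≤ q y)
    (hmean : ∑ y, (meanRow P y - q y) ^ 2 ≤ c ^ 4 / (2 * Fintype.card ι)) (y : Y) :
    meanRow P y ≤ (1 + c) * q y := by
  have hcard : (1 : ℝ) ≤ Fintype.card ι := Nat.one_le_cast.2 Fintype.card_pos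
  have hsq : (meanRow P y - q y) ^ 2 ≤ (c ^ 2) ^ 2 := by
    calc (meanRow P y - q y) ^ 2 ≤ ∑ k, (meanRow P k - q k) ^ 2 :=
          Finset.single_le_sum (f := fun k => (meanRow P k - q k) ^ 2)
            (fun k _ => sq_nonneg _) (Finset.mem_univ y)
      _ ≤ c ^ 4 / (2 * Fintype.card ι) := hmean
      _ ≤ c ^ 4 := div_le_self (by positivity) (by linarith)
      _ = (c ^ 2) ^ 2 := by ring
  linarith [abs_le_of_sq_le_sq' hsq (by positivity), mul_le_mul_of_nonneg_left (hcq y) hc]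

theorem mean_norm_add_sum_sub_smul_sq_le {P : Matrix ι Y ℝ} {q : Y → ℝ} {c : ℝ} (hc0 : 0 < c)
    (hP1 : ∀ i, ∑ y, P i y = 1) (hcP : ∀ i y, c ≤ P i y)
    (hq1 : ∑ y, q y = 1) (hcq : ∀ y, c ≤ q y)
    (hmean : ∑ y, (meanRow P y - q y) ^ 2 ≤ c ^ 4 / (2 * Fintype.card ι)) (μ : E) (g : Y → E) :
    (∑ i, ‖μ + ∑ y, (P i y - q y) • g y‖ ^ 2) / Fintype.card ι ≤
      (1 + 1 / Fintype.card ι) * (‖μ‖ ^ 2 + (1 - c / 2) * ∑ y, q y * ‖g y‖ ^ 2) := by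
  have hq0 (y : Y) : 0 ≤ q y := hc0.le.trans (hcq y)
  have hq_le (y : Y) : q y ≤ 1 := hq1 ▸ Finset.single_le_sum (fun k _ => hq0 k) (Finset.mem_univ y)
  obtain ⟨y₀⟩ : Nonempty Y := not_isEmpty_iff.1 fun _ => by simp at hq1
  have hc1 : c ≤ 1 := (hcq y₀).trans (hq_le y₀)
  have hV : 0 ≤ ∑ y, q y * ‖g y‖ ^ 2 :=
    Finset.sum_nonneg fun y _ => mul_nonneg (hq0 y) (by positivity)
  have hexpand := mean_norm_add_sq_le μ fun i => ∑ y, (P i y - q y) • g y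
  rw [inv_card_smul_sum_sum_sub_smul] at hexpand
  have hfluct := card_mul_norm_sq_sum_meanRow_sub_smul_le hc0 hc1 hcq hmean g
  have hvar := mean_norm_sum_sub_smul_sq_le hc1 hP1 hq1
    (fun i y => (mul_le_of_le_one_right hc0.le (hq_le y)).trans (hcP i y))
    (meanRow_le_one_add_mul hc0.le hcq hmean) g
  have hcard : 0 ≤ 1 / (Fintype.card ι : ℝ) * ((1 - c / 2) * ∑ y, q y * ‖g y‖ ^ 2) :=
    mul_nonneg (by positivity) (mul_nonneg (by linarith) hV)
  linarith

end QuadraticForm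

/-! ### The second moment bound -/

section SecondMoment

open Matrix

variable {X Y : Type*} [Fintype Y]

theorem permanent_gram_le {ι : Type*} [Fintype ι] [DecidableEq ι] [Nonempty ι] {P : Matrix ι Y ℝ}
    {q : Y → ℝ} {c : ℝ} (hc0 : 0 < c) (hP1 : ∀ i, ∑ y, P i y = 1) (hcP : ∀ i y, c ≤ P i y)
    (hq1 : ∑ y, q y = 1) (hcq : ∀ y, c ≤ q y)
    (hmean : ∑ y, (meanRow P y - q y) ^ 2 ≤ c ^ 4 / (2 * Fintype.card ι)) :
    (of fun i j => ∑ y, P i y * P j y / q y).permanent ≤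
      (Fintype.card ι).factorial * (Real.exp 1 * (c / 2)⁻¹ ^ Fintype.card Y) := by
  have hq (y : Y) : 0 < q y := hc0.trans_le (hcq y)
  have hgram : (of fun i j => ∑ y, P i y * P j y / q y) =
      of fun i j => 1 + ∑ y, (P i y - q y) / √(q y) * ((P j y - q y) / √(q y)) := by
    ext i j
    exact sum_mul_div_eq_one_add hq (hP1 i) (hP1 j) hq1
  have hc1 : c ≤ 1 := by
    obtain ⟨y, -⟩ : (Finset.univ : Finset Y).Nonempty :=
      Finset.nonempty_of_sum_ne_zero (hq1 ▸ one_ne_zero)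
    exact (hcq y).trans (hq1 ▸ Finset.single_le_sum (fun k _ => (hq k).le) (Finset.mem_univ y))
  rw [hgram]
  refine (permanent_one_add_gram_le (of fun i y => (P i y - q y) / √(q y)) (ρ := 1 - c / 2)
    (K := 1 + 1 / Fintype.card ι) (by linarith) (by linarith) (by positivity)
    fun μ w => ?_).trans ?_
  · -- `w = √q • g` turns the weighted norm `∑ q ‖g‖²` into `∑ ‖w‖²`.
    have hvec (i : ι) : ∑ y, ((P i y - q y) / √(q y) : ℝ) * w y =
        ∑ y, (P i y - q y) • (√(q y))⁻¹ • w y := by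
      simp_rw [smul_smul, ← div_eq_mul_inv, Complex.real_smul]
    have hnorm : ∑ y, ‖w y‖ ^ 2 = ∑ y, q y * ‖(√(q y))⁻¹ • w y‖ ^ 2 := by
      refine Finset.sum_congr rfl fun y _ => ?_
      rw [norm_smul, mul_pow, norm_inv, inv_pow, Real.norm_eq_abs, sq_abs, Real.sq_sqrt (hq y).le,
        mul_inv_cancel_left₀ (hq y).ne']
    simpa only [of_apply, hvec, hnorm] using
      mean_norm_add_sum_sub_smul_sq_le hc0 hP1 hcP hq1 hcq hmean μ fun y => (√(q y))⁻¹ • w y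
  · rw [sub_sub_cancel]
    gcongr
    simpa [neg_div] using Real.one_sub_div_pow_le_exp_neg (n := Fintype.card ι) (t := -1)
      (by linarith [(Fintype.card ι).cast_nonneg (α := ℝ)])

theorem sum_sq_permKernel_div_prod_le [DecidableEq Y] {W : Matrix X Y ℝ} (hW : IsChannel W) {c : ℝ}
    (hc : 0 < c) (hcW : ∀ x y, c ≤ W x y) {n : ℕ} (hn : n ≠ 0) (x : Fin n → X) {q : Y → ℝ}
    (hq1 : ∑ y, q y = 1) (hcq : ∀ y, c ≤ q y)
    (hmean : ∑ y, (meanRow (W.submatrix x id) y - q y) ^ 2 ≤ c ^ 4 / (2 * n)) :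
    ∑ y : Fin n → Y, permKernel W x y ^ 2 / ∏ i, q (y i) ≤
      Real.exp 1 * (c / 2)⁻¹ ^ Fintype.card Y := by
  have : NeZero n := ⟨hn⟩
  rw [sum_sq_permKernel_div_prod_eq, div_le_iff₀' (by positivity)]
  simpa using permanent_gram_le (P := W.submatrix x id) hc (fun i => hW.row_sum (x i))
    (fun i => hcW (x i)) hq1 hcq (by simpa using hmean)

end SecondMoment

/-! ### A Cauchy–Schwarz converse -/

section Converse

variable {Ω U J : Type*} [Fintype Ω] [Fintype U] [DecidableEq U]

theorem sum_decoded_le_card {Q : J → Ω → ℝ} (hQ : ∀ i ω, 0 ≤ Q i ω) (hQ1 : ∀ i, ∑ ω, Q i ω = 1)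
    (dec : Ω → Option U) {j : U → J} {S : Finset J} (hj : ∀ u, j u ∈ S) :
    ∑ u, ∑ ω, (if dec ω = some u then Q (j u) ω else 0) ≤ S.card := by
  rw [Finset.sum_comm]
  calc ∑ ω, ∑ u, (if dec ω = some u then Q (j u) ω else 0)
      ≤ ∑ ω, ∑ i ∈ S, Q i ω := by
        refine Finset.sum_le_sum fun ω _ => ?_
        cases dec ω with
        | none => simpa using Finset.sum_nonneg fun i _ => hQ i ω
        | some v =>
          simp only [Option.some.injEq, Finset.sum_ite_eq, Finset.mem_univ, if_true]
          exact Finset.single_le_sum (f := fun i => Q i ω) (fun i _ => hQ i ω) (hj v)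
    _ = S.card := by
        rw [Finset.sum_comm]
        simp [hQ1]

theorem sq_sum_decoded_le (P : U → Ω → ℝ) {Q : J → Ω → ℝ} (hQ : ∀ i ω, 0 < Q i ω)
    (hQ1 : ∀ i, ∑ ω, Q i ω = 1) (dec : Ω → Option U) {j : U → J} {S : Finset J}
    (hj : ∀ u, j u ∈ S) :
    (∑ u, ∑ ω, if dec ω = some u then P u ω else 0) ^ 2 ≤
      (∑ u, ∑ ω, P u ω ^ 2 / Q (j u) ω) * S.card := by
  have hQ0 (i : J) (ω : Ω) : 0 ≤ Q i ω := (hQ i ω).le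
  have hnonneg : 0 ≤ ∑ u, ∑ ω, P u ω ^ 2 / Q (j u) ω :=
    Finset.sum_nonneg fun u _ => Finset.sum_nonneg fun ω _ => div_nonneg (sq_nonneg _) (hQ0 _ _)
  refine le_trans ?_ (mul_le_mul_of_nonneg_left (sum_decoded_le_card hQ0 hQ1 dec hj) hnonneg)
  rw [← Fintype.sum_prod_type', ← Fintype.sum_prod_type', ← Fintype.sum_prod_type']
  refine Finset.sum_sq_le_sum_mul_sum_of_sq_le_mul _
    (fun _ _ => div_nonneg (sq_nonneg _) (hQ0 _ _)) (fun _ _ => ?_) fun _ _ => ?_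
  · split_ifs
    exacts [hQ0 _ _, le_rfl]
  · split_ifs
    · rw [div_mul_cancel₀ _ (hQ _ _).ne']
    · simp

theorem sq_mul_card_messages_le [Nonempty U] {P : U → Ω → ℝ} {Q : J → Ω → ℝ}
    (hQ : ∀ i ω, 0 < Q i ω) (hQ1 : ∀ i, ∑ ω, Q i ω = 1) {dec : Ω → Option U} {j : U → J}
    {S : Finset J} (hj : ∀ u, j u ∈ S) {R s : ℝ} (hs : 0 ≤ s)
    (hR : ∀ u, ∑ ω, P u ω ^ 2 / Q (j u) ω ≤ R)
    (hsucc : s * Fintype.card U ≤ ∑ u, ∑ ω, if dec ω = some u then P u ω else 0) :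
    s ^ 2 * Fintype.card U ≤ R * S.card := by
  have hU : (0 : ℝ) < Fintype.card U := Nat.cast_pos.2 Fintype.card_pos
  have hsum : ∑ u, ∑ ω, P u ω ^ 2 / Q (j u) ω ≤ Fintype.card U * R := by
    simpa using Finset.sum_le_sum fun u (_ : u ∈ Finset.univ) => hR u
  refine le_of_mul_le_mul_left ?_ hU
  calc Fintype.card U * (s ^ 2 * Fintype.card U) = (s * Fintype.card U) ^ 2 := by ring
    _ ≤ (∑ u, ∑ ω, if dec ω = some u then P u ω else 0) ^ 2 := by gcongr
    _ ≤ (∑ u, ∑ ω, P u ω ^ 2 / Q (j u) ω) * S.card := sq_sum_decoded_le P hQ hQ1 dec hj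
    _ ≤ Fintype.card U * R * S.card := by gcongr
    _ = Fintype.card U * (R * S.card) := mul_assoc _ _ _

theorem one_sub_mul_le_sum_decoded {X Y : Type*} [Fintype Y] [DecidableEq Y] {W : Matrix X Y ℝ}
    (hW : IsChannel W) {n M : ℕ} (hM : M ≠ 0) (c : Code X Y n M) {ε : ℝ}
    (hε : avgError W c ≤ ε) :
    (1 - ε) * M ≤ ∑ u, ∑ y, if c.dec y = some u then permKernel W (c.enc u) y else 0 := by
  have htotal : ∑ u, ∑ y, (if c.dec y = some u then permKernel W (c.enc u) y else 0) +
      ∑ u, ∑ y, (if c.dec y ≠ some u then permKernel W (c.enc u) y else 0) = M := by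
    have hterm (u : Fin M) (y : Fin n → Y) :
        (if c.dec y = some u then permKernel W (c.enc u) y else 0) +
          (if c.dec y ≠ some u then permKernel W (c.enc u) y else 0) =
        permKernel W (c.enc u) y := by
      by_cases h : c.dec y = some u <;> simp [h]
    simp_rw [← Finset.sum_add_distrib, hterm, sum_permKernel hW]
    simp
  rw [avgError, div_le_iff₀ (by positivity)] at hε
  linarith

end Converse

/-! ### Grid cells -/

section Grid

variable {V ι : Type*} [NormedAddCommGroup V] [InnerProductSpace ℝ V] [Fintype ι]

/-- The cell of `v` in the cubical grid with edges parallel to the basis `b` and of length `1 / s`,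
indexed by the integer coordinates of the cell. -/
def gridCell (b : OrthonormalBasis ι ℝ V) (s : ℝ) (v : V) (i : ι) : ℤ :=
  ⌊s * inner ℝ (b i) v⌋

theorem norm_sub_sq_le_of_gridCell_eq {b : OrthonormalBasis ι ℝ V} {s : ℝ} (hs : 0 < s) {v v' : V}
    (h : gridCell b s v = gridCell b s v') : ‖v - v'‖ ^ 2 ≤ Fintype.card ι / s ^ 2 := by
  have hcoord (i : ι) : ‖inner ℝ (b i) (v - v')‖ ^ 2 ≤ 1 / s ^ 2 := by
    have hlt := Int.abs_sub_lt_one_of_floor_eq_floor (congrFun h i)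
    rw [← mul_sub, ← inner_sub_right, abs_mul, abs_of_pos hs] at hlt
    rw [← one_div_pow, Real.norm_eq_abs]
    gcongr
    rw [le_div_iff₀' hs]
    exact hlt.le
  rw [← b.sum_sq_norm_inner_right]
  calc ∑ i, ‖inner ℝ (b i) (v - v')‖ ^ 2 ≤ ∑ _i : ι, 1 / s ^ 2 :=
        Finset.sum_le_sum fun i _ => hcoord i
    _ = Fintype.card ι / s ^ 2 := by simp [div_eq_mul_inv]

variable [DecidableEq ι]

theorem gridCell_mem_piFinset (b : OrthonormalBasis ι ℝ V) {s B : ℝ} (hs : 0 ≤ s) {v : V}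
    (hv : ‖v‖ ≤ B) :
    gridCell b s v ∈ Fintype.piFinset fun _ : ι => Finset.Icc (-⌈s * B⌉₊ : ℤ) ⌈s * B⌉₊ := by
  simp only [Fintype.mem_piFinset, Finset.mem_Icc]
  intro i
  have habs : |s * inner ℝ (b i) v| ≤ ⌈s * B⌉₊ := by
    rw [abs_mul, abs_of_nonneg hs]
    refine le_trans (mul_le_mul_of_nonneg_left ?_ hs) (Nat.le_ceil _)
    simpa using (abs_real_inner_le_norm (b i) v).trans (by simpa using hv)
  rw [abs_le] at habs
  exact ⟨Int.le_floor.2 (by exact_mod_cast habs.1),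
    Int.floor_le_iff.2 (habs.2.trans_lt (by push_cast; linarith))⟩

theorem card_piFinset_Icc_neg (k : ℕ) :
    (Fintype.piFinset fun _ : ι => Finset.Icc (-k : ℤ) k).card = (2 * k + 1) ^ Fintype.card ι := by
  rw [Fintype.card_piFinset, Finset.prod_const, Int.card_Icc, Finset.card_univ]
  congr 1
  lia

theorem exists_grid {E : Type*} [NormedAddCommGroup E] [InnerProductSpace ℝ E]
    [FiniteDimensional ℝ E] {P : Set E} (hP : P.Nonempty) {B : ℝ} (hB : ∀ p ∈ P, ‖p‖ ≤ B) {s : ℝ}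
    (hs : 0 < s) :
    ∃ (j : P → Fin (Module.finrank ℝ (affineSpan ℝ P).direction) → ℤ) (S : Finset _),
      (∀ p, j p ∈ S) ∧
      S.card = (2 * ⌈s * (2 * B)⌉₊ + 1) ^ Module.finrank ℝ (affineSpan ℝ P).direction ∧
      ∀ p q, j p = j q →
        ‖(p : E) - q‖ ^ 2 ≤ Module.finrank ℝ (affineSpan ℝ P).direction / s ^ 2 := by
  obtain ⟨p₀, hp₀⟩ := hP
  let v (p : P) : (affineSpan ℝ P).direction := ⟨p - p₀,
    AffineSubspace.vsub_mem_direction (subset_affineSpan ℝ P p.2) (subset_affineSpan ℝ P hp₀)⟩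
  have hv (p : P) : ‖v p‖ ≤ 2 * B := by
    rw [Submodule.coe_norm]
    linarith [norm_sub_le (p : E) p₀, hB p p.2, hB p₀ hp₀]
  refine ⟨fun p => gridCell (stdOrthonormalBasis ℝ _) s (v p), _,
    fun p => gridCell_mem_piFinset _ hs.le (hv p), ?_, fun p q hpq => ?_⟩
  · rw [card_piFinset_Icc_neg, Fintype.card_fin]
  · simpa [v, Submodule.coe_norm] using norm_sub_sq_le_of_gridCell_eq hs hpq

theorem exists_grid_card_le_mul_sqrt_pow {E : Type*} [NormedAddCommGroup E] [InnerProductSpace ℝ E]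
    [FiniteDimensional ℝ E] {P : Set E} (hP : P.Nonempty) (hbdd : Bornology.IsBounded P) {δ : ℝ}
    (hδ : 0 < δ) :
    ∃ C : ℝ, 0 < C ∧ ∀ n : ℕ, n ≠ 0 →
      ∃ (j : P → Fin (Module.finrank ℝ (affineSpan ℝ P).direction) → ℤ) (S : Finset _),
        (∀ p, j p ∈ S) ∧
        S.card ≤ C * √n ^ Module.finrank ℝ (affineSpan ℝ P).direction ∧
        ∀ p q, j p = j q → ‖(p : E) - q‖ ^ 2 ≤ δ / n := by
  obtain ⟨B, hB0, hB⟩ := hbdd.exists_pos_norm_le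
  set d : ℕ := Module.finrank ℝ (affineSpan ℝ P).direction
  -- A cube of side `1 / (t * √n)` in dimension `d` has squared diameter `d / (t ^ 2 * n) ≤ δ / n`.
  let t : ℝ := √((d + 1) / δ)
  have : 0 < t := by positivity
  refine ⟨(4 * (t * B) + 3) ^ d, by positivity, fun n hn => ?_⟩
  have hn1 : 1 ≤ √(n : ℝ) := Real.one_le_sqrt.2 (Nat.one_le_cast.2 (Nat.pos_of_ne_zero hn))
  obtain ⟨j, S, hj, hS, hclose⟩ := exists_grid hP hB (s := t * √n) (by positivity)
  refine ⟨j, S, hj, ?_, fun p q hpq => (hclose p q hpq).trans ?_⟩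
  · have hside : (2 * ⌈t * √n * (2 * B)⌉₊ + 1 : ℝ) ≤ (4 * (t * B) + 3) * √n := by
      linarith [Nat.ceil_lt_add_one (show 0 ≤ t * √n * (2 * B) by positivity)]
    rw [hS, ← mul_pow]
    push_cast
    gcongr
  · rw [mul_pow, Real.sq_sqrt (by positivity), Real.sq_sqrt n.cast_nonneg, ← div_div,
      div_div_eq_mul_div]
    gcongr
    rw [div_le_iff₀ (by positivity)]
    linarith

end Grid

/-! ### The size of codes -/

section CodeSize

variable {X Y : Type*}

theorem toLp_meanRow_submatrix_mem_polytope (W : Matrix X Y ℝ) {ι : Type*} [Fintype ι] [Nonempty ι]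
    (x : ι → X) : WithLp.toLp 2 (meanRow (W.submatrix x id)) ∈ polytope W := by
  have hmean : WithLp.toLp 2 (meanRow (W.submatrix x id)) =
      ∑ i, (Fintype.card ι : ℝ)⁻¹ • row W (x i) := by
    ext y
    simp [meanRow, row, ← Finset.mul_sum, div_eq_inv_mul]
  rw [hmean]
  exact (convex_convexHull ℝ _).sum_mem (fun _ _ => by positivity) (by simp)
    fun i _ => subset_convexHull ℝ _ ⟨_, rfl⟩

theorem le_apply_of_mem_polytope {W : Matrix X Y ℝ} {c : ℝ}
    (hcW : ∀ x y, c ≤ W x y) {p : EuclideanSpace ℝ Y} (hp : p ∈ polytope W) (y : Y) : c ≤ p y := by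
  have hconvex : Convex ℝ {p : EuclideanSpace ℝ Y | c ≤ p y} :=
    (convex_Ici c).linear_preimage (EuclideanSpace.proj y : EuclideanSpace ℝ Y →L[ℝ] ℝ).toLinearMap
  have hrow : Set.range (row W) ⊆ {p | c ≤ p y} := Set.range_subset_iff.2 fun x => hcW x y
  exact convexHull_min hrow hconvex hp

variable [Fintype Y] {W : Matrix X Y ℝ}

theorem sum_eq_one_of_mem_polytope (hW : IsChannel W) {p : EuclideanSpace ℝ Y}
    (hp : p ∈ polytope W) : ∑ y, p y = 1 :=
  (polytope_subset_refRegion hW hp).2.2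

theorem sq_one_sub_mul_card_messages_le [DecidableEq Y] (hW : IsChannel W) {c : ℝ} (hc : 0 < c)
    (hcW : ∀ x y, c ≤ W x y) {n : ℕ} (hn : n ≠ 0) {M : ℕ} (hM : M ≠ 0) (code : Code X Y n M) {ε : ℝ}
    (hε1 : ε ≤ 1) (hε : avgError W code ≤ ε) {J : Type*} {j : polytope W → J} {S : Finset J}
    (hj : ∀ p, j p ∈ S)
    (hclose : ∀ p q, j p = j q → ‖(p : EuclideanSpace ℝ Y) - q‖ ^ 2 ≤ c ^ 4 / (2 * n)) :
    (1 - ε) ^ 2 * M ≤ Real.exp 1 * (c / 2)⁻¹ ^ Fintype.card Y * S.card := by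
  have : NeZero n := ⟨hn⟩
  have : NeZero M := ⟨hM⟩
  let p (u : Fin M) : polytope W := ⟨_, toLp_meanRow_submatrix_mem_polytope W (code.enc u)⟩
  have : Nonempty (polytope W) := ⟨p 0⟩
  let r : J → polytope W := Function.invFun j
  have hr (u : Fin M) : j (p u) = j (r (j (p u))) := (Function.invFun_eq ⟨p u, rfl⟩).symm
  have hrc (i : J) (y : Y) : c ≤ (r i : EuclideanSpace ℝ Y) y :=
    le_apply_of_mem_polytope hcW (r i).2 y
  have hr1 (i : J) : ∑ y, (r i : EuclideanSpace ℝ Y) y = 1 := sum_eq_one_of_mem_polytope hW (r i).2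
  simpa using sq_mul_card_messages_le (U := Fin M) (P := fun u => permKernel W (code.enc u))
    (Q := fun i y => ∏ k, (r i : EuclideanSpace ℝ Y) (y k)) (j := fun u => j (p u))
    (fun i y => Finset.prod_pos fun k _ => hc.trans_le (hrc i (y k)))
    (fun i => by
      rw [← Fintype.prod_sum fun (_ : Fin n) y => (r i : EuclideanSpace ℝ Y) y]
      simp [hr1])
    (fun u => hj (p u)) (sub_nonneg.2 hε1)
    (fun u => sum_sq_permKernel_div_prod_le hW hc hcW hn _ (hr1 _) (hrc _) <| by
      simpa [p, EuclideanSpace.norm_sq_eq] using hclose _ _ (hr u))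
    (by simpa using one_sub_mul_le_sum_decoded hW hM code hε)

theorem exists_forall_achievableSizes_le [DecidableEq Y] [Nonempty X] (hW : IsChannel W) {c : ℝ}
    (hc : 0 < c) (hcW : ∀ x y, c ≤ W x y) {ε : ℝ} (hε : ε < 1) :
    ∃ C : ℝ, 0 < C ∧ ∀ n : ℕ, n ≠ 0 → ∀ M ∈ achievableSizes W n ε,
      (M : ℝ) ≤ C * √n ^ dimP W := by
  have hP : (polytope W).Nonempty := (Set.range_nonempty _).convexHull
  have hbdd : Bornology.IsBounded (polytope W) :=
    isBounded_outputSimplex.subset ((polytope_subset_refRegion hW).trans Set.inter_subset_right)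
  obtain ⟨C, hC, hgrid⟩ :=
    exists_grid_card_le_mul_sqrt_pow hP hbdd (show 0 < c ^ 4 / 2 by positivity)
  have : 0 < 1 - ε := sub_pos.2 hε
  refine ⟨Real.exp 1 * (c / 2)⁻¹ ^ Fintype.card Y * C / (1 - ε) ^ 2, by positivity, ?_⟩
  rintro n hn M ⟨hM, code, hcode⟩
  obtain ⟨j, S, hj, hS, hclose⟩ := hgrid n hn
  have hsize := sq_one_sub_mul_card_messages_le hW hc hcW hn (Nat.one_le_iff_ne_zero.1 hM) code
    hε.le hcode hj fun p q hpq => (hclose p q hpq).trans_eq (div_div _ _ _)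
  rw [div_mul_eq_mul_div, le_div_iff₀' (by positivity), mul_assoc]
  exact hsize.trans (mul_le_mul_of_nonneg_left hS (by positivity))

theorem nonempty_of_one_le_dimP (hd : 1 ≤ dimP W) : Nonempty X := by
  by_contra hX
  rw [not_nonempty_iff] at hX
  rw [dimP, polytope, Set.range_eq_empty (row W)] at hd
  simp at hd

end CodeSize

end NoisyPerm

end

theorem mainTheorem2_general {X Y : Type*} [Nonempty X] [Fintype Y] [DecidableEq Y]
    (W : Matrix X Y ℝ) (hW : NoisyPerm.IsChannel W) {c : ℝ} (hc : 0 < c)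
    (hcW : ∀ x y, c ≤ W x y) (a : ℝ) (ha : 0 < a) (ε : ℝ) (hε : ε ∈ Set.Ico (0 : ℝ) 1) :
    ∃ C : ℝ, ∀ n : ℕ, n ≠ 0 →
      Real.logb 2 (NoisyPerm.Mstar W n ε) ≤
        NoisyPerm.dimP W * Real.logb 2 (Real.sqrt n / a)
          + Real.logb 2 (NoisyPerm.lambdaStar W) + C := by
  obtain ⟨D, hD, hsize⟩ := NoisyPerm.exists_forall_achievableSizes_le hW hc hcW hε.2
  refine ⟨Real.logb 2 D + NoisyPerm.dimP W * Real.logb 2 a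
    - Real.logb 2 (NoisyPerm.lambdaStar W), fun n hn => ?_⟩
  have hmem := (NoisyPerm.isGreatest_Mstar hW n hε.1 hε.2).1
  have hM : (0 : ℝ) < NoisyPerm.Mstar W n ε := Nat.cast_pos.2 hmem.1
  have hsqrt : 0 < √(n : ℝ) := by positivity
  have hlog := Real.logb_le_logb_of_le one_lt_two hM (hsize n hn _ hmem)
  rw [Real.logb_mul hD.ne' (by positivity), Real.logb_pow] at hlog
  rw [Real.logb_div hsqrt.ne' ha.ne']
  linarith

theorem mainTheorem2 {X Y : Type*} [Fintype X] [Fintype Y] [DecidableEq Y]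
    (W : Matrix X Y ℝ) (hW : NoisyPerm.IsChannel W)
    (hpos : ∀ x y, 0 < W x y) (hd : 1 ≤ NoisyPerm.dimP W)
    (a : ℝ) (ha : 0 < a) (ε : ℝ) (hε : ε ∈ Set.Ioo (0 : ℝ) 1) :
    ∃ C : ℝ, ∀ᶠ n : ℕ in Filter.atTop,
      Real.logb 2 (NoisyPerm.Mstar W n ε) ≤
        NoisyPerm.dimP W * Real.logb 2 (Real.sqrt n / a)
          + Real.logb 2 (NoisyPerm.lambdaStar W) + C := by
  have : Nonempty X := NoisyPerm.nonempty_of_one_le_dimP hd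
  have : Nonempty Y := not_isEmpty_iff.1 fun _ => by
    simpa using hW.row_sum (Classical.arbitrary X)
  obtain ⟨⟨x₁, y₁⟩, hmin⟩ := Finite.exists_min fun p : X × Y => W p.1 p.2
  obtain ⟨C, hC⟩ := mainTheorem2_general W hW (hpos x₁ y₁) (fun x y => hmin (x, y)) a ha ε
    (Set.Ioo_subset_Ico_self hε)
  exact ⟨C, (Filter.eventually_ne_atTop 0).mono hC⟩
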